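/- All graphs are finite, simple and undirected. Let $\mathcal G,\mathcal H$ be graphs with disjoint vertex sets $V(\mathcal G),V(\mathcal H)$ and put $V=V(\mathcal G)\cup V(\mathcal H)$. \emph{Definitions.} A non-signalling box $\mathsf P(a,b\,|\,x,y)$ is a family of probability distributions on pairs of outputs, indexed by pairs of inputs, in which the marginal law of each party's output does not depend on the other party's input. In the isomorphism game of $(\mathcal G,\mathcal H)$, Alice and Bob receive $x_A,x_B\in V$ and answer $y_A,y_B\in V$. They win if, for each party, the question and the answer lie in different vertex sets, and, writing $g_A,g_B\in V(\mathcal G)$ and $h_A,h_B\in V(\mathcal H)$ for the vertices so exchanged, $g_A,g_B$ are equal (resp. adjacent, resp. neither) if and only if $h_A,h_B$ are. A non-signalling strategy for the game is perfect if it wins with probability $1$ on every pair of questions, and $\mathcal G\cong_{ns}\mathcal H$ means that one exists. The diameter $\mathrm{diam}(\mathcal G)$ is the largest distance between two vertices of $\mathcal G$ that lie in the same connected component. A common equitable partition of $\mathcal G$ and $\mathcal H$ consists of partitions $\{C_1,\dots,C_k\}$ of $V(\mathcal G)$ and $\{D_1,\dots,D_k\}$ of $V(\mathcal H)$ into nonempty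 cells with $|C_i|=|D_i|$, and numbers $c_{ij}$ such that every vertex of $C_i$ has exactly $c_{ij}$ neighbours in $C_j$ and every vertex of $D_i$ has exactly $c_{ij}$ neighbours in $D_j$. For $\alpha,\beta\ge0$ with $\alpha+\beta\le1$, $\mathtt{PR}_{\alpha,\beta}=\alpha\,\mathtt{PR}+\beta\,\mathsf P_0+(1-\alpha-\beta)\,\mathsf P_1$, where, for bits $x,y,a,b$, $\mathtt{PR}(a,b\,|\,x,y)=\tfrac12$ if $a\oplus b=xy$ and $0$ otherwise, and $\mathsf P_c$ always outputs $a=b=c$. A box simulates $\mathtt{PR}_{\alpha,\beta}$ if one use of it, with local pre-processing of the inputs and local post-processing of the outputs, produces exactly the correlations $\mathtt{PR}_{\alpha,\beta}$. A box collapses communication complexity if there is $p>\tfrac12$ such that for all $n,m$ and all $f:\{0,1\}^n\times\{0,1\}^m\to\{0,1\}$ there is a protocol in which Alice and Bob, holding $X\in\{0,1\}^n$ and $Y\in\{0,1\}^m$, use shared randomness, finitely many copies of the box and one bit of communication from Bob to Alice, and Alice outputs $f(X,Y)$ with probability at least $p$ for every $(X,Y)$. \textbf{Theorem.} Let $\mathcal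 G\cong_{ns}\mathcal H$ with $\mathrm{diam}(\mathcal G)\ge2$, and let $\mathcal H=\mathcal H_1\sqcup\mathcal H_2$ be disconnected: $V(\mathcal H)$ is the disjoint union of the nonempty sets $V(\mathcal H_1)$ and $V(\mathcal H_2)$, with no edge between them. Suppose that $\mathcal G$ and $\mathcal H$ have a common equitable partition, with cells $C_i$ and $D_i$ $(1\le i\le k)$, such that $$\frac{|D_i\cap \mathcal H_1|}{|D_i|}=\frac{|D_j\cap \mathcal H_1|}{|D_j|}\qquad\text{for all } i,j\in\{1,\dots,k\}.$$ Then the isomorphism game of $(\mathcal G,\mathcal H)$ has a perfect non-signalling strategy that simulates $\mathtt{PR}_{\alpha,\beta}$ for some $\alpha>0$ and $\beta\ge0$ with $\alpha+\beta\le1$, and that collapses communication complexity. -/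

import Mathlib

namespace NonlocalGame

open scoped BigOperators

/-! ### Non-signalling boxes -/

/-- A bipartite non-signalling box (equivalently, a non-signalling strategy) with finite output
alphabets: `prob x y a b` is `P(a, b | x, y)`, and the marginal of either party does not depend on
the input of the other party. -/
structure NSBox (X Y A B : Type*) [Fintype A] [Fintype B] where
  prob : X → Y → A → B → ℝ
  nonneg : ∀ x y a b, 0 ≤ prob x y a b
  sum_eq_one : ∀ x y, ∑ a, ∑ b, prob x y a b = 1
  marginal_left : ∀ x y y' a, ∑ b, prob x y a b = ∑ b, prob x y' a b
  marginal_right : ∀ x x' y b, ∑ a, prob x y a b = ∑ a, prob x' y a b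

/-- The box `PR`: uniform on the pairs of bits with `a ⊕ b = x y`. -/
noncomputable def boxPR (x y a b : Bool) : ℝ := if (a ^^ b) = (x && y) then 1 / 2 else 0

/-- The box `P_c` whose outputs are both the constant bit `c`. -/
noncomputable def boxConst (c : Bool) (_x _y a b : Bool) : ℝ := if a = c ∧ b = c then 1 else 0

/-- The box `PR_{α,β} = α PR + β P_0 + (1 - α - β) P_1`. -/
noncomputable def boxNoisyPR (α β : ℝ) (x y a b : Bool) : ℝ :=
  α * boxPR x y a b + β * boxConst false x y a b + (1 - α - β) * boxConst true x y a b

/-- One use of the box `S`, with local pre-processing of the input bits and local post-processing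
of the outputs of `S`, reproduces exactly the correlations `T` with binary inputs and outputs. -/
def Simulates {X Y A B : Type*} [Fintype A] [Fintype B] (S : NSBox X Y A B)
    (T : Bool → Bool → Bool → Bool → ℝ) : Prop :=
  ∃ (preA : Bool → X) (preB : Bool → Y) (postA : Bool → A → Bool) (postB : Bool → B → Bool),
    ∀ x y a b : Bool, T x y a b =
      ∑ u : A, ∑ v : B,
        if postA x u = a ∧ postB y v = b then S.prob (preA x) (preB y) u v else 0

/-! ### Communication complexity assisted by a non-signalling box -/

/-- The behaviour of one party holding its halves of `N` copies of a box (local inputs in `X`,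
local outputs in `A`), each of which it uses once. `h t` is the output obtained at the `t`-th use.
At time `t` the party uses the copy `copy h t` with the input `query h t`; both choices depend only
on the outputs obtained before time `t`. -/
structure LocalProc (N : ℕ) (X A : Type*) where
  copy : (Fin N → A) → Equiv.Perm (Fin N)
  query : (Fin N → A) → Fin N → X
  causal : ∀ h h' t, (∀ s, s < t → h s = h' s) → copy h t = copy h' t ∧ query h t = query h' t

/-- The input given to the `i`-th copy, when the local outputs are `h` in order of use. -/
def LocalProc.inputAt {N : ℕ} {X A : Type*} (L : LocalProc N X A) (h : Fin N → A) (i : Fin N) : X :=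
  L.query h ((L.copy h).symm i)

/-- The output given by the `i`-th copy, when the local outputs are `h` in order of use. -/
def LocalProc.outputAt {N : ℕ} {X A : Type*} (L : LocalProc N X A) (h : Fin N → A) (i : Fin N) :
    A :=
  h ((L.copy h).symm i)

/-- A protocol with one bit of communication, for input strings of `n` bits (Alice) and `m` bits
(Bob), using `N` copies of a box and a shared random variable with values in `Fin K` and law `law`.
Bob uses his halves of the copies and sends the bit `message` to Alice, who then uses
her halves of the copies and produces her guess. -/
structure OneBitProtocol (X Y A B : Type*) (n m : ℕ) where
  N : ℕ
  K : ℕ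
  law : Fin K → ℝ
  law_nonneg : ∀ r, 0 ≤ law r
  law_sum : ∑ r, law r = 1
  bob : (Fin m → Bool) → Fin K → LocalProc N Y B
  message : (Fin m → Bool) → Fin K → (Fin N → B) → Bool
  alice : (Fin n → Bool) → Fin K → Bool → LocalProc N X A
  guess : (Fin n → Bool) → Fin K → Bool → (Fin N → A) → Bool

/-- The probability that Alice's guess equals the bit `z` on the input strings `xs`, `ys`, when the
copies are independent copies of the box `S`. -/
noncomputable def OneBitProtocol.guessProb {X Y A B : Type*} [Fintype A] [Fintype B] {n m : ℕ}
    (Q : OneBitProtocol X Y A B n m) (S : NSBox X Y A B)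
    (xs : Fin n → Bool) (ys : Fin m → Bool) (z : Bool) : ℝ :=
  ∑ r : Fin Q.K, Q.law r *
    ∑ hA : Fin Q.N → A, ∑ hB : Fin Q.N → B,
      if Q.guess xs r (Q.message ys r hB) hA = z then
        ∏ i : Fin Q.N,
          S.prob ((Q.alice xs r (Q.message ys r hB)).inputAt hA i) ((Q.bob ys r).inputAt hB i)
            ((Q.alice xs r (Q.message ys r hB)).outputAt hA i) ((Q.bob ys r).outputAt hB i)
      else 0

/-- The box `S` collapses communication complexity: there is `p > 1/2` such that every Boolean
function of two bit strings, of whatever lengths, is computed with probability at least `p` on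
every input by a protocol with one bit of communication, shared randomness, and finitely many
copies of `S`. -/
def CollapsesCC {X Y A B : Type*} [Fintype A] [Fintype B] (S : NSBox X Y A B) : Prop :=
  ∃ p : ℝ, 1 / 2 < p ∧
    ∀ (n m : ℕ) (f : (Fin n → Bool) → (Fin m → Bool) → Bool),
      ∃ Q : OneBitProtocol X Y A B n m, ∀ xs ys, p ≤ Q.guessProb S xs ys (f xs ys)

/-! ### The graph isomorphism game -/

section Game

variable {V W : Type*}

/-- The question `x` and the answer `y` are in different vertex sets; `g` is the one among them
which is a vertex of the first graph and `h` the one which is a vertex of the second graph. -/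
def IsAnswer (x y : V ⊕ W) (g : V) (h : W) : Prop :=
  (x = Sum.inl g ∧ y = Sum.inr h) ∨ (x = Sum.inr h ∧ y = Sum.inl g)

/-- The winning condition of the isomorphism game of `(G, H)`. -/
def Wins (G : SimpleGraph V) (H : SimpleGraph W) (xA xB yA yB : V ⊕ W) : Prop :=
  ∃ gA hA gB hB, IsAnswer xA yA gA hA ∧ IsAnswer xB yB gB hB ∧
    (gA = gB ↔ hA = hB) ∧
    (G.Adj gA gB ↔ H.Adj hA hB) ∧
    ((gA ≠ gB ∧ ¬ G.Adj gA gB) ↔ (hA ≠ hB ∧ ¬ H.Adj hA hB))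

/-- A non-signalling strategy for the isomorphism game of two graphs on `V` and `W`. -/
abbrev IsoStrategy (V W : Type*) [Fintype V] [Fintype W] :=
  NSBox (V ⊕ W) (V ⊕ W) (V ⊕ W) (V ⊕ W)

open Classical in
/-- The probability of winning on the questions `xA`, `xB`. -/
noncomputable def winProb [Fintype V] [Fintype W] (G : SimpleGraph V) (H : SimpleGraph W)
    (S : IsoStrategy V W) (xA xB : V ⊕ W) : ℝ :=
  ∑ yA, ∑ yB, if Wins G H xA xB yA yB then S.prob xA xB yA yB else 0

/-- The strategy `S` is perfect: it wins with probability one on every pair of questions. -/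
def IsPerfect [Fintype V] [Fintype W] (G : SimpleGraph V) (H : SimpleGraph W)
    (S : IsoStrategy V W) : Prop :=
  ∀ xA xB, winProb G H S xA xB = 1

/-- `G ≅_ns H`. -/
def NSIsomorphic [Fintype V] [Fintype W] (G : SimpleGraph V) (H : SimpleGraph W) : Prop :=
  ∃ S : IsoStrategy V W, IsPerfect G H S

/-- The diameter, as the largest distance between two connected vertices (so that it is meaningful
for a finite graph that is not connected). -/
noncomputable def diameter (G : SimpleGraph V) : ℕ :=
  sSup {d | ∃ u v, G.Reachable u v ∧ G.dist u v = d}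

/-- `H = H₁ ⊔ H₂`: the vertex set is the disjoint union of two nonempty sets with no edge between
them. -/
structure IsDisconnection (H : SimpleGraph W) (H₁ H₂ : Set W) : Prop where
  nonempty_left : H₁.Nonempty
  nonempty_right : H₂.Nonempty
  disjoint : Disjoint H₁ H₂
  union_eq : H₁ ∪ H₂ = Set.univ
  not_adj : ∀ u ∈ H₁, ∀ v ∈ H₂, ¬ H.Adj u v

/-- A common equitable partition of `G` and `H` with `k` (nonempty) cells, given by the colourings
`colG`, `colH` of the vertices, the cell sizes `size i` and the partition parameters `deg i j`. -/
structure CommonEquitablePartition (G : SimpleGraph V) (H : SimpleGraph W) (k : ℕ) where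
  colG : V → Fin k
  colH : W → Fin k
  size : Fin k → ℕ
  deg : Fin k → Fin k → ℕ
  size_pos : ∀ i, 0 < size i
  ncard_colG : ∀ i, {g | colG g = i}.ncard = size i
  ncard_colH : ∀ i, {h | colH h = i}.ncard = size i
  equitable_left : ∀ g j, {g' | G.Adj g g' ∧ colG g' = j}.ncard = deg (colG g) j
  equitable_right : ∀ h j, {h' | H.Adj h h' ∧ colH h' = j}.ncard = deg (colH h) j

/-- The cell `D_i` of the partition of the second graph. -/
def CommonEquitablePartition.cellH {G : SimpleGraph V} {H : SimpleGraph W} {k : ℕ}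
    (E : CommonEquitablePartition G H k) (i : Fin k) : Set W := {h | E.colH h = i}

end Game

end NonlocalGame

open NonlocalGame

open NonlocalGame

namespace NonlocalGame

open scoped BigOperators

/-! ### Boxes simulating a noisy `PR` box collapse communication complexity -/

/-! The strategy exchanges only vertices of corresponding cells. Given the questions, it draws
uniformly among the answers whose pair stands in the same relation (equal, adjacent, neither) as the
question pair. As both graphs share the cell sizes and degrees, the number of such answers is the
same whichever graph the questions come from. Hence each marginal is uniform on a cell whatever the
other question is (`sum_weight_right`, `sum_weight_left`): the strategy is non-signalling, and
perfect by construction.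

Diameter at least two yields an induced path g₁ - g₂ - g₃ in `G`. Alice asks g₂ on 0 and g₁ on 1,
Bob asks g₂ on 0 and g₃ on 1, and each outputs the side of `H` containing the answer. Unless both
inputs are 1, the questions are equal or adjacent, hence so are the answers, and the sides agree. On
inputs (1, 1) opposite sides occur with positive probability α/2. The proportion hypothesis makes
all marginals of these bits equal, and such a box must be `PR_{α,β}` (`eq_boxNoisyPR`).

For the collapse, the correlator of `PR_{α,β}` is 1 except on inputs (1, 1), where it is 1 - 2α.
Taking parities over independent copies multiplies correlators, so one copy for each possible string
of Bob detects `f(X, Y) = 1` with one-sided error (`Simulates.collapsesCC`). -/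

/-- The sign `(-1)^b` of a bit. -/
def bitSign (b : Bool) : ℝ := if b then -1 else 1

open Classical in
/-- The sum modulo two of a family of bits. -/
noncomputable def parity {ι : Type*} [Fintype ι] (c : ι → Bool) : Bool :=
  decide (∏ i, bitSign (c i) = -1)

/-- Turns parities into products, so that independence of the copies becomes a factorisation. -/
theorem bitSign_parity {ι : Type*} [Fintype ι] (c : ι → Bool) :
    bitSign (parity c) = ∏ i, bitSign (c i) := by
  have h : ∏ i, bitSign (c i) = 1 ∨ ∏ i, bitSign (c i) = -1 := by
    refine Finset.prod_induction _ (fun r : ℝ => r = 1 ∨ r = -1) ?_ (Or.inl rfl) ?_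
    · rintro a b (rfl | rfl) (rfl | rfl) <;> norm_num
    · intro i _
      cases c i <;> simp [bitSign]
  unfold parity
  rcases h with h | h <;> rw [h] <;> norm_num [bitSign]

/-- The behaviour which uses the copies in order, with inputs fixed in advance. -/
def LocalProc.nonadaptive {N : ℕ} {X A : Type*} (q : Fin N → X) : LocalProc N X A where
  copy _ := Equiv.refl _
  query _ := q
  causal _ _ _ _ := ⟨rfl, rfl⟩

theorem sum_sum_prod_eq_prod_sum_sum {ι A B : Type*} [Fintype ι] [DecidableEq ι] [Fintype A]
    [Fintype B] (F : ι → A → B → ℝ) :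
    ∑ hA : ι → A, ∑ hB : ι → B, ∏ i, F i (hA i) (hB i) = ∏ i, ∑ a, ∑ b, F i a b := by
  simp_rw [Fintype.prod_sum]

theorem Simulates.sum_bitSign {X Y A B : Type*} [Fintype A] [Fintype B] {S : NSBox X Y A B}
    {T : Bool → Bool → Bool → Bool → ℝ} {preA : Bool → X} {preB : Bool → Y}
    {postA : Bool → A → Bool} {postB : Bool → B → Bool}
    (h : ∀ x y a b : Bool, T x y a b =
      ∑ u : A, ∑ v : B,
        if postA x u = a ∧ postB y v = b then S.prob (preA x) (preB y) u v else 0)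
    (x y : Bool) :
    ∑ u, ∑ v, bitSign (postA x u) * bitSign (postB y v) * S.prob (preA x) (preB y) u v =
      T x y false false + T x y true true - T x y false true - T x y true false := by
  simp only [h, ← Finset.sum_add_distrib, ← Finset.sum_sub_distrib]
  refine Finset.sum_congr rfl fun u _ => Finset.sum_congr rfl fun v _ => ?_
  cases postA x u <;> cases postB y v <;> simp [bitSign]

/-- `β` drops out because both constant boxes have correlator 1, while `PR` has correlator
(-1)^(xy). -/
theorem boxNoisyPR_correlator (α β : ℝ) (x y : Bool) :
    boxNoisyPR α β x y false false + boxNoisyPR α β x y true true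
      - boxNoisyPR α β x y false true - boxNoisyPR α β x y true false =
    if x && y then 1 - 2 * α else 1 := by
  cases x <;> cases y <;> simp [boxNoisyPR, boxPR, boxConst] <;> ring

theorem sum_sum_prod_prob {ι X Y A B : Type*} [Fintype ι] [DecidableEq ι] [Fintype A] [Fintype B]
    (S : NSBox X Y A B) (q : ι → X) (q' : ι → Y) :
    ∑ hA : ι → A, ∑ hB : ι → B, ∏ i, S.prob (q i) (q' i) (hA i) (hB i) = 1 := by
  rw [sum_sum_prod_eq_prod_sum_sum fun i => S.prob (q i) (q' i)]
  simp [S.sum_eq_one]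

/-- The distribution of the parity of the post-processed outputs of independent copies. -/
theorem sum_prod_parity_eq {ι X Y A B : Type*} [Fintype ι] [DecidableEq ι] [Fintype A] [Fintype B]
    (S : NSBox X Y A B) (q : ι → X) (q' : ι → Y) (c : ι → A → Bool) (c' : ι → B → Bool)
    (z : Bool) :
    (∑ hA : ι → A, ∑ hB : ι → B,
      if ((parity fun i => c i (hA i)) ^^ (parity fun i => c' i (hB i))) = z then
        ∏ i, S.prob (q i) (q' i) (hA i) (hB i) else 0) =
      (1 + bitSign z * ∏ i, ∑ u, ∑ v,
        bitSign (c i u) * bitSign (c' i v) * S.prob (q i) (q' i) u v) / 2 := by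
  -- The indicator of `a ⊕ b = z` is (1 + (-1)^(a+b+z)) / 2. With 1 written as the total
  -- probability, the identity holds term by term.
  rw [← sum_sum_prod_eq_prod_sum_sum fun i u v =>
    bitSign (c i u) * bitSign (c' i v) * S.prob (q i) (q' i) u v, ← sum_sum_prod_prob S q q']
  simp only [Finset.mul_sum, ← Finset.sum_add_distrib, Finset.sum_div, Finset.prod_mul_distrib,
    ← bitSign_parity]
  refine Finset.sum_congr rfl fun hA _ => Finset.sum_congr rfl fun hB _ => ?_
  cases parity fun i => c i (hA i) <;> cases parity fun i => c' i (hB i) <;> cases z <;>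
    simp [bitSign]

/-- A box which simulates `PR_{α,β}` with `α > 0` collapses communication complexity: with copies
indexed by the strings `z`, used on the bits `f(X, z)` and `[Y = z]`, the parity of all outputs is
`0` if `f(X, Y) = 0`, and `1` with probability `α` otherwise; mixing this guess with the constant
guess `1` makes both success probabilities equal to `1 / (2 - α)`. -/
theorem Simulates.collapsesCC {X Y A B : Type*} [Fintype A] [Fintype B] {S : NSBox X Y A B}
    {α β : ℝ} (hα : 0 < α) (hα1 : α ≤ 1) (hS : Simulates S (boxNoisyPR α β)) : CollapsesCC S := by
  obtain ⟨preA, preB, postA, postB, h⟩ := hS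
  have hpos : 0 < 2 - α := by linarith
  refine ⟨1 / (2 - α), by rw [div_lt_div_iff₀] <;> linarith, fun n m f => ?_⟩
  let e := Fintype.equivFin (Fin m → Bool)
  let Q : OneBitProtocol X Y A B n m :=
    { N := Fintype.card (Fin m → Bool)
      K := 2
      law := ![(1 - α) / (2 - α), 1 / (2 - α)]
      law_nonneg := by
        have : 0 ≤ 1 - α := by linarith
        intro r
        fin_cases r
        · exact div_nonneg this hpos.le
        · exact div_nonneg zero_le_one hpos.le
      law_sum := by
        simp only [Fin.sum_univ_two, Matrix.cons_val_zero, Matrix.cons_val_one]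
        field_simp
        ring
      bob := fun ys _ => LocalProc.nonadaptive fun i => preB (decide (ys = e.symm i))
      message := fun ys _ hB => parity fun i => postB (decide (ys = e.symm i)) (hB i)
      alice := fun xs _ _ => LocalProc.nonadaptive fun i => preA (f xs (e.symm i))
      guess := fun xs r b hA =>
        if r = 0 then true else (parity fun i => postA (f xs (e.symm i)) (hA i)) ^^ b }
  refine ⟨Q, fun xs ys => ?_⟩
  have key : Q.guessProb S xs ys (f xs ys) =
      (1 - α) / (2 - α) * (∑ hA : Fin (Fintype.card (Fin m → Bool)) → A,
        ∑ hB : Fin (Fintype.card (Fin m → Bool)) → B,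
        if true = f xs ys then ∏ i, S.prob (preA (f xs (e.symm i)))
          (preB (decide (ys = e.symm i))) (hA i) (hB i) else 0) +
      1 / (2 - α) * (∑ hA : Fin (Fintype.card (Fin m → Bool)) → A,
        ∑ hB : Fin (Fintype.card (Fin m → Bool)) → B,
        if ((parity fun i => postA (f xs (e.symm i)) (hA i)) ^^
          (parity fun i => postB (decide (ys = e.symm i)) (hB i))) = f xs ys then
        ∏ i, S.prob (preA (f xs (e.symm i)))
          (preB (decide (ys = e.symm i))) (hA i) (hB i) else 0) := by
    unfold OneBitProtocol.guessProb
    exact Fin.sum_univ_two _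
  -- Only the copy indexed by Bob's own string can receive both inputs 1.
  have hprod : (∏ i, if f xs (e.symm i) && decide (ys = e.symm i) then 1 - 2 * α else 1)
      = if f xs ys then 1 - 2 * α else 1 := by
    rw [Finset.prod_eq_single (e ys)]
    · simp
    · intro i _ hi
      have : ys ≠ e.symm i := fun hh => hi (by rw [hh, Equiv.apply_symm_apply])
      simp [this]
    · simp
  rw [key, sum_prod_parity_eq S (fun i => preA (f xs (e.symm i)))
    (fun i => preB (decide (ys = e.symm i))) (fun i => postA (f xs (e.symm i)))
    (fun i => postB (decide (ys = e.symm i)))]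
  simp only [Simulates.sum_bitSign h, boxNoisyPR_correlator, hprod]
  cases hf : f xs ys
  · simp [bitSign]
  · simp only [if_true, sum_sum_prod_prob S (fun i => preA (f xs (e.symm i)))
      (fun i => preB (decide (ys = e.symm i)))]
    simp only [bitSign, if_true]
    apply le_of_eq
    field_simp
    ring

/-! ### The strategy given by a common equitable partition -/

section Strategy

variable {V W : Type*} {G : SimpleGraph V} {H : SimpleGraph W} {k : ℕ}

open Classical in
/-- The relation between two vertices: `none` if they are equal, `some true` if they are adjacent,
`some false` otherwise. -/
noncomputable def vertexRel (G : SimpleGraph V) (g g' : V) : Option Bool :=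
  if g = g' then none else some (decide (G.Adj g g'))

theorem vertexRel_eq_none {g g' : V} : vertexRel G g g' = none ↔ g = g' := by
  unfold vertexRel
  split_ifs <;> simp_all

theorem vertexRel_eq_some_true {g g' : V} : vertexRel G g g' = some true ↔ G.Adj g g' := by
  unfold vertexRel
  split_ifs with h
  · simp [h]
  · simp

theorem vertexRel_eq_some_false {g g' : V} :
    vertexRel G g g' = some false ↔ g ≠ g' ∧ ¬ G.Adj g g' := by
  unfold vertexRel
  split_ifs with h <;> simp [h]

theorem vertexRel_comm (G : SimpleGraph V) (g g' : V) : vertexRel G g g' = vertexRel G g' g := by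
  by_cases h : g = g' <;> simp [vertexRel, h, eq_comm (a := g'), G.adj_comm g]

/-- The number of vertices in a given relation to a given vertex `u`, in a cell with `s` vertices
of which `d` are adjacent to `u` and `e` are equal to `u`. -/
def relCount (s d e : ℝ) : Option Bool → ℝ
  | none => e
  | some true => d
  | some false => s - d - e

theorem sum_indicator_eq_ncard [Fintype V] (p : V → Prop) [DecidablePred p] :
    ∑ v, (if p v then (1 : ℝ) else 0) = ({v | p v}.ncard : ℝ) := by
  rw [Finset.sum_boole, Set.ncard_eq_toFinset_card', Set.toFinset_ofPred]

open Classical in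
theorem sum_indicator_vertexRel [Fintype V] (G : SimpleGraph V) (col : V → Fin k) (u : V)
    (j : Fin k) (ρ : Option Bool) :
    ∑ v, (if col v = j ∧ vertexRel G u v = ρ then (1 : ℝ) else 0) =
      relCount ({v | col v = j}.ncard : ℝ) ({v | G.Adj u v ∧ col v = j}.ncard : ℝ)
        (if col u = j then 1 else 0) ρ := by
  have h0 : ∑ v, (if u = v ∧ col u = j then (1 : ℝ) else 0) = if col u = j then 1 else 0 := by
    simp [ite_and]
  match ρ with
  | none =>
    simp only [relCount, vertexRel_eq_none]
    rw [← h0]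
    refine Finset.sum_congr rfl fun v _ => if_congr ?_ rfl rfl
    constructor
    · rintro ⟨rfl, rfl⟩; simp
    · rintro ⟨rfl, rfl⟩; simp
  | some true =>
    simp only [relCount, vertexRel_eq_some_true]
    rw [← sum_indicator_eq_ncard]
    exact Finset.sum_congr rfl fun v _ => if_congr and_comm rfl rfl
  | some false =>
    simp only [relCount, vertexRel_eq_some_false]
    -- Complementary counting: remove from the cell the neighbours of `u` and, if it lies there, `u`
    -- itself.
    rw [← sum_indicator_eq_ncard, ← sum_indicator_eq_ncard, ← h0, ← Finset.sum_sub_distrib,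
      ← Finset.sum_sub_distrib]
    refine Finset.sum_congr rfl fun v _ => ?_
    by_cases huv : u = v
    · subst huv
      by_cases hc : col u = j <;> simp [hc]
    · by_cases hc : col v = j <;> by_cases ha : G.Adj u v <;> simp [huv, hc, ha]

namespace CommonEquitablePartition

variable (E : CommonEquitablePartition G H k)

open Classical in
/-- The number of vertices of the `j`-th cell in the relation `ρ` to a vertex of the `i`-th cell. -/
noncomputable def relDeg (ρ : Option Bool) (i j : Fin k) : ℝ :=
  relCount (E.size j) (E.deg i j) (if i = j then 1 else 0) ρ

-- The value is the same expression as in `sum_vertexRel_right`; this agreement is where the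
-- partition being common enters.
open Classical in
theorem sum_vertexRel_left [Fintype V] (g : V) (j : Fin k) (ρ : Option Bool) :
    ∑ g', (if E.colG g' = j ∧ vertexRel G g g' = ρ then (1 : ℝ) else 0) =
      E.relDeg ρ (E.colG g) j := by
  rw [sum_indicator_vertexRel, E.ncard_colG, E.equitable_left, relDeg]

open Classical in
theorem sum_vertexRel_right [Fintype W] (h : W) (j : Fin k) (ρ : Option Bool) :
    ∑ h', (if E.colH h' = j ∧ vertexRel H h h' = ρ then (1 : ℝ) else 0) =
      E.relDeg ρ (E.colH h) j := by
  rw [sum_indicator_vertexRel, E.ncard_colH, E.equitable_right, relDeg]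

open Classical in
theorem sum_colG [Fintype V] (i : Fin k) :
    ∑ g, (if E.colG g = i then (1 : ℝ) else 0) = E.size i := by
  rw [sum_indicator_eq_ncard, E.ncard_colG]

open Classical in
theorem sum_colH [Fintype W] (i : Fin k) :
    ∑ h, (if E.colH h = i then (1 : ℝ) else 0) = E.size i := by
  rw [sum_indicator_eq_ncard, E.ncard_colH]

open Classical in
theorem size_mul_relDeg_eq_sum [Fintype V] (ρ : Option Bool) (i j : Fin k) :
    E.size i * E.relDeg ρ i j =
      ∑ g, ∑ g', if E.colG g = i ∧ E.colG g' = j ∧ vertexRel G g g' = ρ then (1 : ℝ) else 0 := by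
  rw [← E.sum_colG, Finset.sum_mul]
  refine Finset.sum_congr rfl fun g _ => ?_
  by_cases hg : E.colG g = i
  · subst hg
    simp [← E.sum_vertexRel_left g]
  · simp [hg]

/-- The number of ordered pairs of vertices in the relation `ρ` in two cells is symmetric. -/
theorem size_mul_relDeg_comm [Fintype V] (ρ : Option Bool) (i j : Fin k) :
    E.size i * E.relDeg ρ i j = E.size j * E.relDeg ρ j i := by
  classical
  rw [size_mul_relDeg_eq_sum, size_mul_relDeg_eq_sum, Finset.sum_comm]
  refine Finset.sum_congr rfl fun g _ => Finset.sum_congr rfl fun g' _ => if_congr ?_ rfl rfl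
  rw [vertexRel_comm]
  tauto

theorem size_pos_real (i : Fin k) : (0 : ℝ) < E.size i := Nat.cast_pos.2 (E.size_pos i)

/-- The vertex `g'` is itself counted, so the normalisation in `weight` never divides by zero on its
support. -/
theorem relDeg_pos [Fintype V] (g g' : V) :
    0 < E.relDeg (vertexRel G g g') (E.colG g) (E.colG g') := by
  classical
  rw [← E.sum_vertexRel_left g]
  refine Finset.sum_pos' (fun _ _ => by split_ifs <;> norm_num) ⟨g', Finset.mem_univ _, ?_⟩
  simp

open Classical in
/-- The joint weight of the exchanged pairs `(g, h)` and `(g', h')`: uniform on the pairs of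
vertices of the two cells which are in the same relation. -/
noncomputable def weight (g : V) (h : W) (g' : V) (h' : W) : ℝ :=
  if E.colG g = E.colH h ∧ E.colG g' = E.colH h' ∧ vertexRel G g g' = vertexRel H h h' then
    (E.size (E.colG g) * E.relDeg (vertexRel G g g') (E.colG g) (E.colG g'))⁻¹ else 0

theorem weight_nonneg [Fintype V] (g : V) (h : W) (g' : V) (h' : W) :
    0 ≤ E.weight g h g' h' := by
  unfold weight
  split_ifs
  · exact inv_nonneg.2 (mul_nonneg (E.size_pos_real _).le (E.relDeg_pos _ _).le)
  · exact le_rfl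

theorem weight_pos [Fintype V] {g : V} {h : W} {g' : V} {h' : W} (h1 : E.colG g = E.colH h)
    (h2 : E.colG g' = E.colH h') (h3 : vertexRel G g g' = vertexRel H h h') :
    0 < E.weight g h g' h' := by
  rw [weight, if_pos ⟨h1, h2, h3⟩]
  exact inv_pos.2 (mul_pos (E.size_pos_real _) (E.relDeg_pos _ _))

theorem vertexRel_eq_of_weight_ne_zero {g : V} {h : W} {g' : V} {h' : W}
    (hw : E.weight g h g' h' ≠ 0) : vertexRel G g g' = vertexRel H h h' := by
  by_contra hne
  exact hw (if_neg fun hh => hne hh.2.2)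

/-- By double counting of related pairs; it lets Bob's marginals be deduced from Alice's. -/
theorem weight_comm [Fintype V] (g : V) (h : W) (g' : V) (h' : W) :
    E.weight g h g' h' = E.weight g' h' g h := by
  unfold weight
  rw [E.size_mul_relDeg_comm, vertexRel_comm G, vertexRel_comm H]
  refine if_congr ?_ rfl rfl
  tauto

open Classical in
/-- The marginal weight of an exchanged pair `(g, h)`: uniform on the cell. -/
noncomputable def marginal (g : V) (h : W) : ℝ :=
  if E.colG g = E.colH h then (E.size (E.colG g) : ℝ)⁻¹ else 0

/-- If the cells match, exactly `relDeg` vertices `h'` contribute, each with weight 1 / (size ·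
`relDeg`). The result is free of `g'`, which is the non-signalling property. -/
theorem sum_weight_right [Fintype V] [Fintype W] (g : V) (h : W) (g' : V) :
    ∑ h', E.weight g h g' h' = E.marginal g h := by
  classical
  by_cases hc : E.colG g = E.colH h
  · have h1 := E.sum_vertexRel_right h (E.colG g') (vertexRel G g g')
    have h2 := (E.relDeg_pos g g').ne'
    have h3 := (E.size_pos_real (E.colG g)).ne'
    rw [marginal, if_pos hc, ← mul_right_cancel_iff_of_pos (E.relDeg_pos g g')]
    conv_rhs => rw [hc, ← h1]
    rw [Finset.sum_mul, Finset.mul_sum]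
    refine Finset.sum_congr rfl fun h' _ => ?_
    rw [← hc, weight]
    simp only [hc, true_and, eq_comm (a := E.colG g'), eq_comm (a := vertexRel G g g')]
    rw [hc] at h2 h3
    split_ifs
    · field_simp
    · simp
  · simp [weight, marginal, hc]

theorem sum_weight_left [Fintype V] [Fintype W] (g : V) (h : W) (h' : W) :
    ∑ g', E.weight g h g' h' = E.marginal g h := by
  classical
  by_cases hc : E.colG g = E.colH h
  · have h1 := E.sum_vertexRel_left g (E.colH h') (vertexRel H h h')
    have h3 := (E.size_pos_real (E.colG g)).ne'
    -- Here the relation is prescribed in `H`, so `h'` is the vertex witnessing that the count is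
    -- positive.
    have h4 : 0 < E.relDeg (vertexRel H h h') (E.colG g) (E.colH h') := by
      rw [hc, ← E.sum_vertexRel_right h]
      refine Finset.sum_pos' (fun _ _ => by split_ifs <;> norm_num) ⟨h', Finset.mem_univ _, ?_⟩
      simp
    have h2 := h4.ne'
    rw [marginal, if_pos hc, ← mul_right_cancel_iff_of_pos h4]
    conv_rhs => rw [← h1]
    rw [Finset.sum_mul, Finset.mul_sum]
    refine Finset.sum_congr rfl fun g' _ => ?_
    rw [weight]
    by_cases hh : E.colG g' = E.colH h' ∧ vertexRel G g g' = vertexRel H h h'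
    · rw [if_pos ⟨hc, hh⟩, if_pos hh, hh.1, hh.2]
      field_simp
    · rw [if_neg fun h => hh h.2, if_neg hh]
      simp
  · simp [weight, marginal, hc]

theorem sum_marginal_right [Fintype W] (g : V) : ∑ h, E.marginal g h = 1 := by
  classical
  have h1 := E.sum_colH (E.colG g)
  have h3 := (E.size_pos_real (E.colG g)).ne'
  rw [← mul_inv_cancel₀ h3]
  conv_rhs => rw [mul_comm]; arg 2; rw [← h1]
  rw [mul_comm, Finset.sum_mul]
  refine Finset.sum_congr rfl fun h _ => ?_
  simp only [marginal, eq_comm (a := E.colG g), ite_mul, one_mul, zero_mul]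

theorem sum_marginal_left [Fintype V] (h : W) : ∑ g, E.marginal g h = 1 := by
  classical
  have h1 := E.sum_colG (E.colH h)
  have h3 := (E.size_pos_real (E.colH h)).ne'
  rw [← mul_inv_cancel₀ h3]
  conv_rhs => rw [mul_comm]; arg 2; rw [← h1]
  rw [mul_comm, Finset.sum_mul]
  refine Finset.sum_congr rfl fun g _ => ?_
  by_cases hc : E.colG g = E.colH h <;> simp [marginal, hc]

/-- The probabilities of the strategy. -/
noncomputable def strategyProb : V ⊕ W → V ⊕ W → V ⊕ W → V ⊕ W → ℝ
  | .inl g, .inl g', .inr h, .inr h' => E.weight g h g' h'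
  | .inl g, .inr h', .inr h, .inl g' => E.weight g h g' h'
  | .inr h, .inl g', .inl g, .inr h' => E.weight g h g' h'
  | .inr h, .inr h', .inl g, .inl g' => E.weight g h g' h'
  | _, _, _, _ => 0

/-- The law of the answer of one party. -/
noncomputable def strategyMarginal : V ⊕ W → V ⊕ W → ℝ
  | .inl g, .inr h => E.marginal g h
  | .inr h, .inl g => E.marginal g h
  | _, _ => 0

theorem strategyProb_comm [Fintype V] (xA xB yA yB : V ⊕ W) :
    E.strategyProb xA xB yA yB = E.strategyProb xB xA yB yA := by
  rcases xA with _ | _ <;> rcases xB with _ | _ <;> rcases yA with _ | _ <;>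
    rcases yB with _ | _ <;> first | rfl | exact E.weight_comm _ _ _ _

theorem sum_strategyProb [Fintype V] [Fintype W] (xA xB yA : V ⊕ W) :
    ∑ yB, E.strategyProb xA xB yA yB = E.strategyMarginal xA yA := by
  rcases xA with _ | _ <;> rcases xB with _ | _ <;> rcases yA with _ | _ <;>
    simp [strategyProb, strategyMarginal, Fintype.sum_sum_type, sum_weight_left, sum_weight_right]

theorem sum_strategyMarginal [Fintype V] [Fintype W] (x : V ⊕ W) :
    ∑ y, E.strategyMarginal x y = 1 := by
  rcases x with _ | _ <;>
    simp [strategyMarginal, Fintype.sum_sum_type, sum_marginal_left, sum_marginal_right]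

/-- The strategy in which the exchanged pairs lie in corresponding cells and are uniform among those
in the same relation. -/
noncomputable def strategy [Fintype V] [Fintype W] : IsoStrategy V W where
  prob := E.strategyProb
  nonneg xA xB yA yB := by
    rcases xA with _ | _ <;> rcases xB with _ | _ <;> rcases yA with _ | _ <;>
      rcases yB with _ | _ <;> first | exact le_rfl | exact E.weight_nonneg _ _ _ _
  sum_eq_one xA xB := by simp only [sum_strategyProb, sum_strategyMarginal]
  marginal_left xA xB xB' yA := by simp only [sum_strategyProb]
  marginal_right xA xA' xB yB := by
    simp only [E.strategyProb_comm _ xB _ yB, sum_strategyProb]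

/-- Nonzero weight forces equal values of `vertexRel`, which encodes the three equivalences of the
winning condition at once. -/
theorem wins_of_strategyProb_ne_zero {xA xB yA yB : V ⊕ W}
    (h : E.strategyProb xA xB yA yB ≠ 0) : Wins G H xA xB yA yB := by
  have key : ∀ {g h g' h'}, E.weight g h g' h' ≠ 0 →
      (g = g' ↔ h = h') ∧ (G.Adj g g' ↔ H.Adj h h') ∧
        ((g ≠ g' ∧ ¬ G.Adj g g') ↔ (h ≠ h' ∧ ¬ H.Adj h h')) := by
    intro g h g' h' hw
    have := E.vertexRel_eq_of_weight_ne_zero hw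
    simp only [← vertexRel_eq_none (G := G), ← vertexRel_eq_none (G := H),
      ← vertexRel_eq_some_true, this, ne_eq, and_self]
  rcases xA with a | a <;> rcases xB with b | b <;> rcases yA with c | c <;>
    rcases yB with d | d <;> first
      | exact absurd rfl h
      | exact ⟨a, c, b, d, by simp [IsAnswer], by simp [IsAnswer], key h⟩
      | exact ⟨a, c, d, b, by simp [IsAnswer], by simp [IsAnswer], key h⟩
      | exact ⟨c, a, b, d, by simp [IsAnswer], by simp [IsAnswer], key h⟩
      | exact ⟨c, a, d, b, by simp [IsAnswer], by simp [IsAnswer], key h⟩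

theorem isPerfect_strategy [Fintype V] [Fintype W] : IsPerfect G H E.strategy := by
  classical
  intro xA xB
  rw [winProb, ← E.strategy.sum_eq_one xA xB]
  refine Finset.sum_congr rfl fun yA _ => Finset.sum_congr rfl fun yB _ => ?_
  by_cases hz : E.strategyProb xA xB yA yB = 0
  · simp [strategy, hz]
  · rw [if_pos (E.wins_of_strategyProb_ne_zero hz)]

end CommonEquitablePartition

end Strategy

/-! ### Simulation of a noisy `PR` box -/

section Simulation

variable {V W : Type*} {G : SimpleGraph V} {H : SimpleGraph W} {k : ℕ}

/-- A graph of diameter at least two contains an induced path on three vertices. -/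
theorem exists_induced_path_of_two_le_diameter (hdiam : 2 ≤ diameter G) :
    ∃ a b c, G.Adj a b ∧ G.Adj b c ∧ a ≠ c ∧ ¬ G.Adj a c := by
  by_contra! hno
  -- Without an induced path, "equal or adjacent" is transitive, so every walk contracts to at most
  -- one edge.
  have hreach : ∀ u v, G.Walk u v → u = v ∨ G.Adj u v := by
    intro u v p
    induction p with
    | nil => exact Or.inl rfl
    | @cons a b c hab _ ih =>
      rcases ih with rfl | hbc
      · exact Or.inr hab
      · by_cases hac : a = c
        · exact Or.inl hac
        · exact Or.inr (hno a b c hab hbc hac)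
  have hle : diameter G ≤ 1 := by
    -- In `ℕ` the supremum of the empty set is 0, so an upper bound suffices even if there are no
    -- vertices.
    refine csSup_le' ?_
    rintro d ⟨u, v, ⟨p⟩, rfl⟩
    rcases hreach u v p with rfl | hadj
    · simp
    · rw [SimpleGraph.dist_eq_one_iff_adj.2 hadj]
  omega

/-- A family of distributions on pairs of bits which have the same marginals `(p, 1 - p)`, and give
equal bits unless both inputs are `1`, is a noisy `PR` box. -/
theorem eq_boxNoisyPR {T : Bool → Bool → Bool → Bool → ℝ} {p : ℝ}
    (hleft : ∀ x y, T x y false false + T x y false true = p)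
    (hright : ∀ x y, T x y false false + T x y true false = p)
    (hone : ∀ x y, T x y false false + T x y false true + T x y true false + T x y true true = 1)
    (hne : ∀ x y, (x && y) = false → T x y false true = 0) :
    boxNoisyPR (2 * T true true false true) (T true true false false) = T := by
  funext x y a b
  have h1 := hleft x y
  have h2 := hright x y
  have h3 := hone x y
  have h4 := hne x y
  have h5 := hleft true true
  have h6 := hright true true
  have h7 := hone true true
  -- Equal marginals force T(0,1) = T(1,0), which is α/2 on inputs (1, 1), and then β = p - α/2. On
  -- the other inputs T(0,0) = p = α/2 + β.
  cases x <;> cases y <;> cases a <;> cases b <;>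
    simp [boxNoisyPR, boxPR, boxConst] at * <;> linarith

open Classical in
/-- The bit telling in which part of `H` an answer lies: `false` for `H₁`. -/
noncomputable def sideBit (H₁ : Set W) : V ⊕ W → Bool
  -- An arbitrary value: the simulation only asks vertices of `G`, and then such answers have
  -- probability 0.
  | .inl _ => true
  | .inr h => decide (h ∉ H₁)

theorem sideBit_inl (H₁ : Set W) (g : V) : sideBit H₁ (.inl g : V ⊕ W) = true := rfl

theorem sideBit_inr_eq_false {H₁ : Set W} {h : W} :
    sideBit H₁ (.inr h : V ⊕ W) = false ↔ h ∈ H₁ := by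
  simp [sideBit]

theorem sideBit_inr_eq_true {H₁ : Set W} {h : W} :
    sideBit H₁ (.inr h : V ⊕ W) = true ↔ h ∉ H₁ := by
  simp [sideBit]

namespace CommonEquitablePartition

/-- If `H₁` and `H₂` have the same proportion in all cells, then every cell meets both. -/
theorem exists_mem_cell [Fintype W] (E : CommonEquitablePartition G H k) {H₁ H₂ : Set W}
    (hH : IsDisconnection H H₁ H₂)
    (hprop : ∀ i j : Fin k,
      ((E.cellH i ∩ H₁).ncard : ℝ) / ((E.cellH i).ncard : ℝ) =
        ((E.cellH j ∩ H₁).ncard : ℝ) / ((E.cellH j).ncard : ℝ)) (i : Fin k) :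
    (∃ h, E.colH h = i ∧ h ∈ H₁) ∧ ∃ h, E.colH h = i ∧ h ∈ H₂ := by
  have hpos : ∀ j, (0 : ℝ) < (E.cellH j).ncard := fun j => by
    rw [show (E.cellH j).ncard = E.size j from E.ncard_colH j]
    exact E.size_pos_real j
  constructor
  · obtain ⟨u, hu⟩ := hH.nonempty_left
    -- The proportion is positive in the cell of `u`, hence in every cell; below, a vertex of `H₂`
    -- likewise keeps it under 1 everywhere.
    have h1 : 0 < ((E.cellH (E.colH u) ∩ H₁).ncard : ℝ) / ((E.cellH (E.colH u)).ncard : ℝ) :=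
      div_pos (Nat.cast_pos.2 ((Set.ncard_pos (Set.toFinite _)).2 ⟨u, rfl, hu⟩)) (hpos _)
    rw [hprop _ i, div_pos_iff_of_pos_right (hpos i), Nat.cast_pos,
      Set.ncard_pos (Set.toFinite _)] at h1
    exact h1
  · obtain ⟨u, hu⟩ := hH.nonempty_right
    have hlt : (E.cellH (E.colH u) ∩ H₁).ncard < (E.cellH (E.colH u)).ncard := by
      refine Set.ncard_lt_ncard ⟨Set.inter_subset_left, fun hsub => ?_⟩ (Set.toFinite _)
      exact Set.disjoint_left.1 hH.disjoint (hsub (show u ∈ E.cellH (E.colH u) from rfl)).2 hu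
    have h1 : ((E.cellH (E.colH u) ∩ H₁).ncard : ℝ) / ((E.cellH (E.colH u)).ncard : ℝ) < 1 :=
      (div_lt_one (hpos _)).2 (Nat.cast_lt.2 hlt)
    by_contra! hno
    have hsub : E.cellH i ∩ H₁ = E.cellH i := Set.inter_eq_left.2 fun h hh =>
      (hH.union_eq ▸ Set.mem_univ h : h ∈ H₁ ∪ H₂).resolve_right (hno h hh)
    rw [hprop _ i, hsub, div_self (hpos i).ne'] at h1
    exact lt_irrefl _ h1

variable (E : CommonEquitablePartition G H k) [Fintype V] [Fintype W]

/-- The law of the bits telling in which part of `H` the answers to `g` and `g'` lie. -/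
noncomputable def sideProb (H₁ : Set W) (g g' : V) (a b : Bool) : ℝ :=
  ∑ u, ∑ v, if sideBit H₁ u = a ∧ sideBit H₁ v = b then
    E.strategy.prob (.inl g) (.inl g') u v else 0

theorem sideProb_nonneg (H₁ : Set W) (g g' : V) (a b : Bool) : 0 ≤ E.sideProb H₁ g g' a b :=
  Finset.sum_nonneg fun _ _ => Finset.sum_nonneg fun _ _ => by
    split_ifs
    · exact E.strategy.nonneg _ _ _ _
    · exact le_rfl

theorem sideProb_comm (H₁ : Set W) (g g' : V) (a b : Bool) :
    E.sideProb H₁ g g' a b = E.sideProb H₁ g' g b a := by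
  unfold sideProb
  rw [Finset.sum_comm]
  refine Finset.sum_congr rfl fun u _ => Finset.sum_congr rfl fun v _ => if_congr and_comm ?_ rfl
  exact E.strategyProb_comm _ _ _ _

/-- The answer to `g` is uniform on its cell of `H`. The proportion hypothesis later removes the
dependence on `g`. -/
theorem sideProb_left (H₁ : Set W) (g g' : V) :
    E.sideProb H₁ g g' false false + E.sideProb H₁ g g' false true =
      ((E.cellH (E.colG g) ∩ H₁).ncard : ℝ) / ((E.cellH (E.colG g)).ncard : ℝ) := by
  classical
  have h1 : E.sideProb H₁ g g' false false + E.sideProb H₁ g g' false true =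
      ∑ u, if sideBit H₁ u = false then E.strategyMarginal (.inl g) u else 0 := by
    simp only [sideProb, ← Finset.sum_add_distrib, ← E.sum_strategyProb (.inl g) (.inl g')]
    refine Finset.sum_congr rfl fun u _ => ?_
    split_ifs with hu
    · refine Finset.sum_congr rfl fun v _ => ?_
      cases sideBit H₁ v <;> simp [hu, strategy]
    · simp [hu]
  have h2 : (E.cellH (E.colG g)).ncard = E.size (E.colG g) := E.ncard_colH _
  have h3 : ((E.cellH (E.colG g) ∩ H₁).ncard : ℝ) =
      ∑ h, if E.colH h = E.colG g ∧ h ∈ H₁ then 1 else 0 := by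
    rw [sum_indicator_eq_ncard]
    rfl
  rw [h1, h2, h3, Finset.sum_div, Fintype.sum_sum_type]
  simp only [sideBit, Bool.true_eq_false, if_false, Finset.sum_const_zero, zero_add,
    decide_eq_false_iff_not, not_not, strategyMarginal, marginal]
  refine Finset.sum_congr rfl fun h _ => ?_
  by_cases hm : h ∈ H₁ <;> by_cases hc : E.colG g = E.colH h <;> simp [hm, hc, eq_comm]

theorem sideProb_right (H₁ : Set W) (g g' : V) :
    E.sideProb H₁ g g' false false + E.sideProb H₁ g g' true false =
      ((E.cellH (E.colG g') ∩ H₁).ncard : ℝ) / ((E.cellH (E.colG g')).ncard : ℝ) := by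
  rw [E.sideProb_comm _ g, E.sideProb_comm _ g, sideProb_left]

theorem sum_sideProb (H₁ : Set W) (g g' : V) :
    E.sideProb H₁ g g' false false + E.sideProb H₁ g g' false true +
      E.sideProb H₁ g g' true false + E.sideProb H₁ g g' true true = 1 := by
  rw [← E.strategy.sum_eq_one (.inl g) (.inl g')]
  simp only [sideProb, ← Finset.sum_add_distrib]
  refine Finset.sum_congr rfl fun u _ => Finset.sum_congr rfl fun v _ => ?_
  cases sideBit H₁ u <;> cases sideBit H₁ v <;> simp

theorem sideProb_false_true_eq (H₁ : Set W) (g g' : V) :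
    E.sideProb H₁ g g' false true =
      ∑ h, ∑ h', open Classical in if h ∈ H₁ ∧ h' ∉ H₁ then E.weight g h g' h' else 0 := by
  classical
  unfold sideProb
  rw [Fintype.sum_sum_type]
  simp only [Fintype.sum_sum_type, sideBit_inl, sideBit_inr_eq_false, sideBit_inr_eq_true,
    Bool.true_eq_false, false_and, Finset.sum_const_zero, zero_add, strategy,
    strategyProb, ite_self]

/-- Vertices which are equal or adjacent are sent to the same part of a disconnected graph. -/
theorem sideProb_eq_zero {H₁ H₂ : Set W} (hH : IsDisconnection H H₁ H₂) {g g' : V}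
    (hg : g = g' ∨ G.Adj g g') : E.sideProb H₁ g g' false true = 0 := by
  rw [sideProb_false_true_eq]
  refine Finset.sum_eq_zero fun h _ => Finset.sum_eq_zero fun h' _ => ?_
  split_ifs with hm
  · by_contra hw
    have hrel := E.vertexRel_eq_of_weight_ne_zero hw
    rcases hg with hg | hg
    · rw [vertexRel_eq_none.2 hg] at hrel
      exact hm.2 (vertexRel_eq_none.1 hrel.symm ▸ hm.1)
    · rw [vertexRel_eq_some_true.2 hg] at hrel
      have h2 : h' ∈ H₂ := (hH.union_eq ▸ Set.mem_univ h' : h' ∈ H₁ ∪ H₂).resolve_left hm.2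
      exact hH.not_adj h hm.1 h' h2 (vertexRel_eq_some_true.1 hrel.symm)
  · rfl

/-- Vertices on opposite sides are distinct and non-adjacent, just like `g` and `g'`, so this pair
of answers has positive weight. -/
theorem sideProb_pos {H₁ H₂ : Set W} (hH : IsDisconnection H H₁ H₂) {g g' : V}
    (hne : g ≠ g') (hadj : ¬ G.Adj g g') {h h' : W} (hg : E.colH h = E.colG g) (hm : h ∈ H₁)
    (hg' : E.colH h' = E.colG g') (hm' : h' ∈ H₂) : 0 < E.sideProb H₁ g g' false true := by
  have hnot : h' ∉ H₁ := fun hmem => Set.disjoint_left.1 hH.disjoint hmem hm'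
  rw [sideProb_false_true_eq]
  have hnonneg : ∀ u v, 0 ≤ (open Classical in
      if u ∈ H₁ ∧ v ∉ H₁ then E.weight g u g' v else 0) := by
    intro u v
    split_ifs
    · exact E.weight_nonneg _ _ _ _
    · exact le_rfl
  refine Finset.sum_pos' (fun u _ => Finset.sum_nonneg fun v _ => hnonneg u v)
    ⟨h, Finset.mem_univ _, Finset.sum_pos' (fun v _ => hnonneg h v) ⟨h', Finset.mem_univ _, ?_⟩⟩
  rw [if_pos ⟨hm, hnot⟩]
  refine E.weight_pos hg.symm hg'.symm ?_
  rw [vertexRel_eq_some_false.2 ⟨hne, hadj⟩, eq_comm, vertexRel_eq_some_false]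
  exact ⟨fun hh => hnot (hh ▸ hm), hH.not_adj h hm h' hm'⟩

theorem exists_simulates_strategy (hdiam : 2 ≤ diameter G) {H₁ H₂ : Set W}
    (hH : IsDisconnection H H₁ H₂)
    (hprop : ∀ i j : Fin k,
      ((E.cellH i ∩ H₁).ncard : ℝ) / ((E.cellH i).ncard : ℝ) =
        ((E.cellH j ∩ H₁).ncard : ℝ) / ((E.cellH j).ncard : ℝ)) :
    ∃ α β : ℝ, 0 < α ∧ 0 ≤ β ∧ α + β ≤ 1 ∧ Simulates E.strategy (boxNoisyPR α β) := by
  obtain ⟨g₁, g₂, g₃, h12, h23, hne, hnadj⟩ := exists_induced_path_of_two_le_diameter hdiam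
  -- Both parties ask the midpoint on 0 and opposite ends of the path on 1, so only inputs (1, 1)
  -- give a distinct, non-adjacent pair.
  let qA : Bool → V := fun x => if x then g₁ else g₂
  let qB : Bool → V := fun y => if y then g₃ else g₂
  let T : Bool → Bool → Bool → Bool → ℝ := fun x y => E.sideProb H₁ (qA x) (qB y)
  have hT := eq_boxNoisyPR (T := T)
    (p := ((E.cellH (E.colG g₁) ∩ H₁).ncard : ℝ) / ((E.cellH (E.colG g₁)).ncard : ℝ))
    (fun x y => (E.sideProb_left H₁ _ _).trans (hprop _ _))
    (fun x y => (E.sideProb_right H₁ _ _).trans (hprop _ _))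
    (fun x y => E.sum_sideProb H₁ _ _)
    (fun x y hxy => by
      refine E.sideProb_eq_zero hH ?_
      cases x <;> cases y <;> simp_all [qA, qB])
  obtain ⟨u, hu, hu₁⟩ := (E.exists_mem_cell hH hprop (E.colG g₁)).1
  obtain ⟨v, hv, hv₂⟩ := (E.exists_mem_cell hH hprop (E.colG g₃)).2
  have hpos : 0 < T true true false true := E.sideProb_pos hH hne hnadj hu hu₁ hv hv₂
  refine ⟨2 * T true true false true, T true true false false, by linarith,
    E.sideProb_nonneg _ _ _ _ _, ?_, fun x => .inl (qA x), fun y => .inl (qB y),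
    fun _ => sideBit H₁, fun _ => sideBit H₁, ?_⟩
  -- On inputs (1, 1) the marginals give T(0,1) = T(1,0), so α + β = T(0,1) + T(1,0) + T(0,0) = 1 -
  -- T(1,1).
  · have h1 : 0 ≤ T true true true true := E.sideProb_nonneg _ _ _ _ _
    have h2 : T true true false false + T true true false true = _ :=
      (E.sideProb_left H₁ _ _).trans (hprop _ (E.colG g₁))
    have h3 : T true true false false + T true true true false = _ :=
      (E.sideProb_right H₁ _ _).trans (hprop _ (E.colG g₁))
    have h4 : T true true false false + T true true false true + T true true true false +
      T true true true true = 1 := E.sum_sideProb H₁ _ _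
    linarith
  · intro x y a b
    rw [hT]
    rfl

end CommonEquitablePartition

end Simulation

end NonlocalGame

theorem mainTheorem2 {V W : Type*} [Fintype V] [Fintype W]
    (G : SimpleGraph V) (H : SimpleGraph W)
    (hGH : NSIsomorphic G H)
    (hdiam : 2 ≤ diameter G)
    (H₁ H₂ : Set W) (hH : IsDisconnection H H₁ H₂)
    (k : ℕ) (E : CommonEquitablePartition G H k)
    (hprop : ∀ i j : Fin k,
      ((E.cellH i ∩ H₁).ncard : ℝ) / ((E.cellH i).ncard : ℝ) =
        ((E.cellH j ∩ H₁).ncard : ℝ) / ((E.cellH j).ncard : ℝ)) :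
    ∃ S : IsoStrategy V W, IsPerfect G H S ∧
      (∃ α β : ℝ, 0 < α ∧ 0 ≤ β ∧ α + β ≤ 1 ∧ Simulates S (boxNoisyPR α β)) ∧
      CollapsesCC S := by
  obtain ⟨α, β, hα, hβ, hαβ, hS⟩ := E.exists_simulates_strategy hdiam hH hprop
  exact ⟨E.strategy, E.isPerfect_strategy, ⟨α, β, hα, hβ, hαβ, hS⟩,
    hS.collapsesCC hα (by linarith)⟩
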